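/- Let $H_{n,d}$ be the space of real forms (homogeneous polynomials) of degree $d$ in $n$ variables, and let $\Sigma_{n,2d}\subset H_{n,2d}$ be the cone of forms $p=\sum_j q_j^2$ (finite sum) with $q_j\in H_{n,d}$. Let $(n,d)=(3,3)$ or $(n,d)=(4,2)$ and put $m=d^{\,n-1}$, so that $m=9$ or $m=8$ respectively. Let $f_1,\dots,f_{n-1}\in H_{n,d}$ be real forms (two ternary cubics, respectively three quaternary quadrics) that intersect transversely in $m$ distinct projective points $\gamma_1,\dots,\gamma_m$, all of them real; that is, $\gamma_1,\dots,\gamma_m$ are exactly the common zeros of $f_1,\dots,f_{n-1}$ in $\mathbb{CP}^{n-1}$, and at each $\gamma_i$ the gradients of $f_1,\dots,f_{n-1}$ are linearly independent. Let $v_1,\dots,v_m\in\mathbb{R}^n\setminus\{0\}$ be arbitrary affine representatives of $\gamma_1,\dots,\gamma_m$. (a) There are real numbers $u_1,\dots,u_m$, all nonzero, such that $u_1p(v_1)+\dots+u_mp(v_m)=0$ for all $p\in H_{n,d}$ (a Cayley–Bacharach relation), and every real linear relation satisfied by the values at $v_1,\dots,v_m$ of all forms in $H_{n,d}$ is a scalar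 multiple of this one. The rescaled representatives $|u_i|^{1/d}v_i$ satisfy the relation with coefficients $u_i/|u_i|\in\{1,-1\}$. (b) Let $w_1,\dots,w_m\in\mathbb{R}^n\setminus\{0\}$ be any affine representatives of $\gamma_1,\dots,\gamma_m$ for which there are $a_1,\dots,a_m\in\{1,-1\}$ with $a_1p(w_1)+\dots+a_mp(w_m)=0$ for all $p\in H_{n,d}$. Then the image of $\Sigma_{n,2d}$ under the evaluation map $E(p)=(p(w_1),\dots,p(w_m))$ is exactly $$T_m=\Big\{x\in\mathbb{R}^m \;:\; x_i\ge 0 \text{ for all } i,\ \text{ and } \sum_{i=1}^m\sqrt{x_i}\ge 2\sqrt{x_k}\ \text{ for all } k\Big\}.$$ -/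

import Mathlib

noncomputable section

namespace CayleyBacharach

open MvPolynomial

/-- The set `H_{n,d}` of real forms of degree `d` in `n` variables. -/
def forms (n d : ℕ) : Set (MvPolynomial (Fin n) ℝ) :=
  {p | p.IsHomogeneous d}

/-- The cone `Σ_{n,2d}` of sums of squares: forms of degree `2d` in `n` variables that are finite
sums of squares of forms of degree `d`. -/
def sosCone (n d : ℕ) : Set (MvPolynomial (Fin n) ℝ) :=
  {p | p ∈ forms n (2 * d) ∧
    ∃ (r : ℕ) (q : Fin r → MvPolynomial (Fin n) ℝ), (∀ j, q j ∈ forms n d) ∧ p = ∑ j, q j ^ 2}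

/-- The evaluation map `E(p) = (p(w_1), …, p(w_m))`. -/
def evalAt {n m : ℕ} (w : Fin m → Fin n → ℝ) (p : MvPolynomial (Fin n) ℝ) : Fin m → ℝ :=
  fun i => eval (w i) p

/-- The set `T_m` of all `x ≥ 0` in `ℝ^m` with `√x_1 + … + √x_m ≥ 2 √x_k` for all `k`. -/
def T (m : ℕ) : Set (Fin m → ℝ) :=
  {x | (∀ i, 0 ≤ x i) ∧ ∀ k, 2 * √(x k) ≤ ∑ i, √(x i)}

/-- `v_1, …, v_m ∈ ℝ^n` are affine representatives of the points of a fully real transverse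
intersection of the real forms `f_1, …, f_k` of degree `d` : the `v_i` represent pairwise distinct
real projective points, the common zeros of the `f_j` in *complex* projective space are exactly
these points, and at each of them the gradients of the `f_j` are linearly independent. -/
structure IsFullyRealTransverseIntersection {n k m : ℕ} (d : ℕ)
    (f : Fin k → MvPolynomial (Fin n) ℝ) (v : Fin m → Fin n → ℝ) : Prop where
  form : ∀ j, f j ∈ forms n d
  ne_zero : ∀ i, v i ≠ 0
  distinct : ∀ i i', i ≠ i' → ∀ c : ℝ, v i ≠ c • v i'
  zeros : ∀ z : Fin n → ℂ, z ≠ 0 →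
    ((∀ j, aeval z (f j) = 0) ↔ ∃ (i : Fin m) (c : ℂ), z = fun l => c * (v i l : ℂ))
  transverse : ∀ i, LinearIndependent ℝ fun j => fun l => eval (v i) (pderiv l (f j))

/-- `u` is the coefficient vector of a linear relation on the values of forms of degree `d` at the
points `v_i`, that is, `u_1 p(v_1) + … + u_m p(v_m) = 0` for all `p ∈ H_{n,d}`. -/
def IsRelation {n m : ℕ} (d : ℕ) (v : Fin m → Fin n → ℝ) (u : Fin m → ℝ) : Prop :=
  ∀ p ∈ forms n d, ∑ i, u i * eval (v i) p = 0

end CayleyBacharach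

end

namespace CayleyBacharach

open MvPolynomial Module

variable {n d : ℕ}

/-! In both cases the forms have dimension 10, and the `n - 1` independent forms `f j` vanish at all
`m` points, so evaluation has rank at most `10 - (n - 1) = m - 1` and a relation exists
(`exists_relation`). Any `m - 1` of the points are separated by forms (`exists_cubic_of_two_lines`,
`exists_quadric`), so a relation with one zero coefficient is zero. Hence all coefficients are
nonzero, the relation is unique up to a scalar, and the image of evaluation is exactly a hyperplane.
Separation is proved with products of linear forms and conics. The degenerate positions that would
obstruct this are excluded by `not_vanish_of_transverse`, a dimension count with gradients that
plays the role of Bézout's theorem.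

For the image of the cone, a sum of squares of `q j` gives vectors `(q j (w i))_j` of length `√(x
i)` whose sum with signs `a i` is zero, so the triangle inequality yields `T`. Conversely, the
inequalities of `T` are those for a closed plane polygon with sides `√(x i)`
(`exists_closed_polygon`); the real and imaginary parts of its edges, with signs `a i`, satisfy the
relation, so they are the values of two forms, and the sum of their squares takes the values `x i`.
-/

/-! ### Forms, evaluation and gradients -/

instance finiteDimensional_homogeneousSubmodule (n d : ℕ) :
    FiniteDimensional ℝ (homogeneousSubmodule (Fin n) ℝ d) :=
  Module.Finite.iff_fg.mpr (homogeneousSubmodule_fg (Fin n) ℝ d)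

theorem finrank_homogeneousSubmodule (n d : ℕ) :
    finrank ℝ (homogeneousSubmodule (Fin n) ℝ d) = n.multichoose d := by
  have hset : {m : Fin n →₀ ℕ | m.degree = d} =
      ((Finset.univ : Finset (Fin n)).finsuppAntidiag d : Set (Fin n →₀ ℕ)) := by
    ext m
    simp [Finset.mem_finsuppAntidiag, Finsupp.degree_eq_sum]
  rw [homogeneousSubmodule_eq_finsupp_supported, hset]
  have := (AddMonoidAlgebra.supportedEquivFinsupp (S := ℝ) (R := ℝ)
    ((Finset.univ : Finset (Fin n)).finsuppAntidiag d : Set (Fin n →₀ ℕ))).finrank_eq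
  rw [Module.finrank_finsupp_self] at this
  simpa [Finset.card_finsuppAntidiag_nat_eq_multichoose] using this

/-- The gradient of a polynomial at the point `a`. -/
noncomputable def grad (a : Fin n → ℝ) : MvPolynomial (Fin n) ℝ →ₗ[ℝ] (Fin n → ℝ) :=
  LinearMap.pi fun l => (aeval a).toLinearMap ∘ₗ (pderiv l).toLinearMap

theorem grad_apply (a : Fin n → ℝ) (p : MvPolynomial (Fin n) ℝ) (l : Fin n) :
    grad a p l = eval a (pderiv l p) := by
  simp [grad, aeval_eq_eval]

theorem grad_mul (a : Fin n → ℝ) (p q : MvPolynomial (Fin n) ℝ) :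
    grad a (p * q) = eval a p • grad a q + eval a q • grad a p := by
  ext l
  simp [grad_apply, Derivation.leibniz]

/-- The value at `a` as a linear functional on forms. -/
noncomputable def evalForm (d : ℕ) (a : Fin n → ℝ) : homogeneousSubmodule (Fin n) ℝ d →ₗ[ℝ] ℝ :=
  (aeval a).toLinearMap ∘ₗ Submodule.subtype _

@[simp]
theorem evalForm_apply (a : Fin n → ℝ) (p : homogeneousSubmodule (Fin n) ℝ d) :
    evalForm d a p = eval a (p : MvPolynomial (Fin n) ℝ) := by
  simp [evalForm, aeval_eq_eval]

theorem eval_smul_of_isHomogeneous {p : MvPolynomial (Fin n) ℝ} (hp : p.IsHomogeneous d)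
    (c : ℝ) (a : Fin n → ℝ) : eval (c • a) p = c ^ d * eval a p := by
  rw [eval_eq, eval_eq, Finset.mul_sum]
  refine Finset.sum_congr rfl fun m hm => ?_
  have hdeg := hp (mem_support_iff.mp hm)
  rw [← hdeg]
  simp only [Pi.smul_apply, smul_eq_mul, mul_pow, Finset.prod_mul_distrib, Finset.prod_pow_eq_pow_sum]
  have hm' : Finsupp.weight 1 m = ∑ i ∈ m.support, m i := by
    rw [Finsupp.weight_apply]
    simp [Finsupp.sum]
  rw [hm']
  ring

theorem exists_linear_form_separating {S : Submodule ℝ (Fin n → ℝ)} {c : Fin n → ℝ} (hc : c ∉ S) :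
    ∃ p : MvPolynomial (Fin n) ℝ, p.IsHomogeneous 1 ∧ (∀ x ∈ S, eval x p = 0) ∧ eval c p ≠ 0 := by
  obtain ⟨φ, hφc, hφ⟩ := Submodule.exists_le_ker_of_notMem hc
  have key : ∀ x, eval x (∑ i, C (φ (Pi.single i 1)) * X i) = φ x := by
    intro x
    conv_rhs => rw [LinearMap.pi_apply_eq_sum_univ φ x]
    simp only [map_sum, map_mul, eval_C, eval_X, smul_eq_mul]
    refine Finset.sum_congr rfl fun i _ => ?_
    rw [mul_comm]
    congr 2
    ext j
    simp [Pi.single_apply, eq_comm]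
  refine ⟨∑ i, C (φ (Pi.single i 1)) * X i, IsHomogeneous.sum _ _ _ fun i _ => isHomogeneous_C_mul_X _ i, fun x hx => ?_, ?_⟩
  · rw [key]
    exact hφ hx
  · rwa [key]

/-! ### Separated points and dimension counts -/

/-- Forms of degree `d` separate the points `s i`. -/
def Separated {ι : Type*} (d : ℕ) (s : ι → Fin n → ℝ) : Prop :=
  ∀ i, ∃ p : MvPolynomial (Fin n) ℝ, p.IsHomogeneous d ∧ (∀ j, j ≠ i → eval (s j) p = 0) ∧
    eval (s i) p ≠ 0

/-- Separating forms span a complement to the forms vanishing at all `s i`, so the latter have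
codimension `card ι`, too little room for an injective `A`. -/
theorem exists_ne_zero_map_eq_zero {ι V : Type*} [Fintype ι] [AddCommGroup V] [Module ℝ V]
    [FiniteDimensional ℝ V] {s : ι → Fin n → ℝ} (hs : Separated d s)
    (A : V →ₗ[ℝ] homogeneousSubmodule (Fin n) ℝ d)
    (hA : ∀ x i, eval (s i) (A x : MvPolynomial (Fin n) ℝ) = 0)
    (hdim : n.multichoose d < Fintype.card ι + finrank ℝ V) : ∃ x, x ≠ 0 ∧ A x = 0 := by
  choose p hp hp0 hp1 using hs
  let B : V × (ι → ℝ) →ₗ[ℝ] homogeneousSubmodule (Fin n) ℝ d :=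
    A.coprod (Fintype.linearCombination ℝ fun i => (⟨p i, hp i⟩ : homogeneousSubmodule (Fin n) ℝ d))
  have hker : LinearMap.ker B ≠ ⊥ := by
    apply LinearMap.ker_ne_bot_of_finrank_lt
    rw [finrank_homogeneousSubmodule]
    simp
    omega
  obtain ⟨⟨x, y⟩, hxy, hne⟩ := (Submodule.ne_bot_iff _).mp hker
  have hsum : (A x : MvPolynomial (Fin n) ℝ) + ∑ i, y i • p i = 0 := by
    have := congrArg Subtype.val (LinearMap.mem_ker.mp hxy)
    simpa [B, Fintype.linearCombination_apply] using this
  have hy : y = 0 := by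
    ext j
    have h := congrArg (eval (s j)) hsum
    rw [map_add, hA, map_sum, Finset.sum_eq_single j] at h
    · simpa [smul_eval, hp1 j] using h
    · intro i _ hij
      simp [smul_eval, hp0 i j (Ne.symm hij)]
    · simp
  subst hy
  refine ⟨x, fun h => hne (by simp [h]), ?_⟩
  ext1
  simpa using hsum

theorem exists_ne_zero_map_eq_zero_and {ι V : Type*} [Fintype ι] [AddCommGroup V] [Module ℝ V]
    [FiniteDimensional ℝ V] {s : ι → Fin n → ℝ} (hs : Separated d s)
    (A : V →ₗ[ℝ] homogeneousSubmodule (Fin n) ℝ d) (φ : V →ₗ[ℝ] ℝ)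
    (hA : ∀ x i, eval (s i) (A x : MvPolynomial (Fin n) ℝ) = 0)
    (hdim : n.multichoose d + 1 < Fintype.card ι + finrank ℝ V) :
    ∃ x, x ≠ 0 ∧ A x = 0 ∧ φ x = 0 := by
  have hrank := LinearMap.finrank_range_add_finrank_ker φ
  have hr1 : finrank ℝ (LinearMap.range φ) ≤ 1 := by
    simpa using Submodule.finrank_le (LinearMap.range φ)
  have hlt : n.multichoose d < Fintype.card ι + finrank ℝ (LinearMap.ker φ) := by omega
  obtain ⟨x, hne, h0⟩ := exists_ne_zero_map_eq_zero hs (A ∘ₗ (LinearMap.ker φ).subtype)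
    (fun x i => hA x i) hlt
  exact ⟨x, fun h => hne (Subtype.ext h), h0, x.2⟩

/-- If `g` vanished at every `s i`, so would all `f j` and all `g * h`. By dimension there is a
relation `∑ c j • f j + g * h = 0`, nontrivial and with `h (s i₀) = 0`, a condition that costs the
`+ 1`. The gradient at `s i₀` then kills the term `g * h`, so transversality gives `c = 0`, hence `g
* h = 0` and `h = 0`. -/
theorem not_vanish_of_transverse {ι κ : Type*} [Fintype ι] [Fintype κ] {e d' : ℕ}
    (hd : e + d' = d) {f : κ → MvPolynomial (Fin n) ℝ} (hf : ∀ j, (f j).IsHomogeneous d)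
    {g : MvPolynomial (Fin n) ℝ} (hg : g.IsHomogeneous e) (hg0 : g ≠ 0)
    {s : ι → Fin n → ℝ} (hs : Separated d s) (hfs : ∀ j i, eval (s i) (f j) = 0)
    {i₀ : ι} (htr : LinearIndependent ℝ fun j => grad (s i₀) (f j))
    (hdim : n.multichoose d + 1 < Fintype.card ι + Fintype.card κ + n.multichoose d') :
    ∃ i, eval (s i) g ≠ 0 := by
  by_contra! hgs
  obtain ⟨A, hA⟩ : ∃ A : (κ → ℝ) × homogeneousSubmodule (Fin n) ℝ d' →ₗ[ℝ]
      homogeneousSubmodule (Fin n) ℝ d,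
      ∀ x, (A x : MvPolynomial (Fin n) ℝ) = ∑ j, x.1 j • f j + g * x.2 :=
    ⟨(Fintype.linearCombination ℝ fun j =>
      (⟨f j, hf j⟩ : homogeneousSubmodule (Fin n) ℝ d)).coprod
      (LinearMap.restrict (LinearMap.mulLeft ℝ g) fun h hh => hd ▸ hg.mul hh),
      fun x => by simp [Fintype.linearCombination_apply]⟩
  obtain ⟨φ, hφ⟩ : ∃ φ : (κ → ℝ) × homogeneousSubmodule (Fin n) ℝ d' →ₗ[ℝ] ℝ,
      ∀ x, φ x = eval (s i₀) (x.2 : MvPolynomial (Fin n) ℝ) :=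
    ⟨evalForm d' (s i₀) ∘ₗ LinearMap.snd ℝ _ _, fun x => by simp⟩
  have hA0 : ∀ x i, eval (s i) (A x : MvPolynomial (Fin n) ℝ) = 0 := by
    intro x i
    rw [hA]
    simp [hfs, hgs, smul_eval]
  have hlt : n.multichoose d + 1 <
      Fintype.card ι + finrank ℝ ((κ → ℝ) × homogeneousSubmodule (Fin n) ℝ d') := by
    rw [finrank_prod, finrank_homogeneousSubmodule, finrank_fintype_fun_eq_card]
    omega
  obtain ⟨x, hne, h0, hφx⟩ := exists_ne_zero_map_eq_zero_and hs A φ hA0 hlt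
  have hh0 : eval (s i₀) (x.2 : MvPolynomial (Fin n) ℝ) = 0 := by
    rw [← hφ, hφx]
  have hsum : ∑ j, x.1 j • f j + g * (x.2 : MvPolynomial (Fin n) ℝ) = 0 := by
    rw [← hA]
    exact congrArg Subtype.val h0
  have hgrad := congrArg (grad (s i₀)) hsum
  rw [map_add, grad_mul, hgs, hh0] at hgrad
  simp only [map_sum, map_smul, zero_smul, add_zero, map_zero] at hgrad
  have hc : x.1 = 0 := funext (Fintype.linearIndependent_iff.mp htr x.1 hgrad)
  have hx2 : (x.2 : MvPolynomial (Fin n) ℝ) = 0 := by simpa [hg0, hc] using hsum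
  exact hne (Prod.ext hc (Subtype.ext hx2))

theorem exists_form_vanishing {ι : Type*} [Fintype ι] (s : ι → Fin n → ℝ)
    (hdim : Fintype.card ι < n.multichoose d) :
    ∃ p : MvPolynomial (Fin n) ℝ, p.IsHomogeneous d ∧ p ≠ 0 ∧ ∀ i, eval (s i) p = 0 := by
  have hker : LinearMap.ker (LinearMap.pi fun i => evalForm d (s i)) ≠ ⊥ := by
    apply LinearMap.ker_ne_bot_of_finrank_lt
    rwa [finrank_homogeneousSubmodule, finrank_fintype_fun_eq_card]
  obtain ⟨p, hp, hne⟩ := (Submodule.ne_bot_iff _).mp hker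
  refine ⟨p, p.2, fun h => hne (Subtype.ext h), fun i => ?_⟩
  simpa using congrFun (LinearMap.mem_ker.mp hp) i

theorem exists_linear_form_vanishing {ι : Type*} [Fintype ι] (s : ι → Fin n → ℝ)
    (hdim : Fintype.card ι < n) :
    ∃ p : MvPolynomial (Fin n) ℝ, p.IsHomogeneous 1 ∧ p ≠ 0 ∧
      ∀ x ∈ Submodule.span ℝ (Set.range s), eval x p = 0 := by
  have hlt : Submodule.span ℝ (Set.range s) < ⊤ := by
    apply Submodule.lt_top_of_finrank_lt_finrank
    rw [finrank_fintype_fun_eq_card, Fintype.card_fin]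
    exact (finrank_range_le_card s).trans_lt hdim
  obtain ⟨c, -, hc⟩ := SetLike.exists_of_lt hlt
  obtain ⟨p, hp, hpS, hpc⟩ := exists_linear_form_separating hc
  exact ⟨p, hp, fun h => hpc (by simp [h]), hpS⟩

theorem exists_linear_form_through {a b c : Fin n → ℝ} (h : c ∉ Submodule.span ℝ {a, b}) :
    ∃ p : MvPolynomial (Fin n) ℝ, p.IsHomogeneous 1 ∧ eval a p = 0 ∧ eval b p = 0 ∧
      eval c p ≠ 0 := by
  obtain ⟨p, hp, hpS, hpc⟩ := exists_linear_form_separating h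
  exact ⟨p, hp, hpS a (Submodule.subset_span (by simp)), hpS b (Submodule.subset_span (by simp)),
    hpc⟩

/-! ### Transverse zeros and criteria for separation -/

/-- The forms `f j` of degree `d` vanish at the points `q i`, which are pairwise not proportional,
and their gradients at each of these points are linearly independent. -/
structure IsTransverseZeros {ι κ : Type*} (d : ℕ) (f : κ → MvPolynomial (Fin n) ℝ)
    (q : ι → Fin n → ℝ) : Prop where
  form : ∀ j, (f j).IsHomogeneous d
  zero : ∀ j i, eval (q i) (f j) = 0
  notMem_span : ∀ i j, i ≠ j → q i ∉ Submodule.span ℝ {q j}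
  transverse : ∀ i, LinearIndependent ℝ fun j => grad (q i) (f j)

theorem IsTransverseZeros.comp {ι ι' κ : Type*} {f : κ → MvPolynomial (Fin n) ℝ}
    {q : ι → Fin n → ℝ} (h : IsTransverseZeros d f q) {e : ι' → ι} (he : Function.Injective e) :
    IsTransverseZeros d f (q ∘ e) :=
  ⟨h.form, fun j i => h.zero j (e i), fun _ _ hij => h.notMem_span _ _ (he.ne hij),
    fun i => h.transverse (e i)⟩

theorem separated_of_forall_perm {m : ℕ} {q : Fin (m + 1) → Fin n → ℝ}
    (h : ∀ σ : Equiv.Perm (Fin (m + 1)), ∃ p : MvPolynomial (Fin n) ℝ, p.IsHomogeneous d ∧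
      (∀ j : Fin m, eval (q (σ j.succ)) p = 0) ∧ eval (q (σ 0)) p ≠ 0) : Separated d q := by
  intro i
  obtain ⟨p, hp, hp0, hp1⟩ := h (Equiv.swap 0 i)
  refine ⟨p, hp, fun j hj => ?_, by simpa using hp1⟩
  obtain ⟨k, hk⟩ := Fin.exists_succ_eq.mpr (show Equiv.swap 0 i j ≠ 0 by
    intro h0
    apply hj
    simpa using congrArg (Equiv.swap 0 i) h0)
  simpa [hk] using hp0 k

theorem separated_of_notMem_span {q : Fin (d + 1) → Fin n → ℝ}
    (h : ∀ i j, i ≠ j → q i ∉ Submodule.span ℝ {q j}) : Separated d q := by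
  refine separated_of_forall_perm fun σ => ?_
  have h' (j : Fin d) := exists_linear_form_separating
    (h (σ 0) (σ j.succ) (σ.injective.ne (Fin.succ_ne_zero j).symm))
  choose p hp hp0 hp1 using h'
  refine ⟨∏ j, p j, ?_, fun j => ?_, ?_⟩
  · simpa using IsHomogeneous.prod Finset.univ p (fun _ => 1) fun j _ => hp j
  · rw [map_prod]
    exact Finset.prod_eq_zero (Finset.mem_univ j) (hp0 j _ (Submodule.mem_span_singleton_self _))
  · rw [map_prod]
    exact Finset.prod_ne_zero_iff.mpr fun j _ => hp1 j

/-! ### Ternary cubics: eight of the nine points are separated -/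

/-- No two of the points are proportional, and no four of them are collinear. -/
structure NoFourCollinear {ι : Type*} (q : ι → Fin n → ℝ) : Prop where
  notMem_span : ∀ i j, i ≠ j → q i ∉ Submodule.span ℝ {q j}
  notMem_span_pair : ∀ i j k l, i ≠ j → i ≠ k → i ≠ l → j ≠ k → j ≠ l → k ≠ l →
    q k ∈ Submodule.span ℝ {q i, q j} → q l ∉ Submodule.span ℝ {q i, q j}

namespace NoFourCollinear

theorem comp {ι ι' : Type*} {q : ι → Fin n → ℝ} (h : NoFourCollinear q) {e : ι' → ι}
    (he : Function.Injective e) : NoFourCollinear (q ∘ e) :=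
  ⟨fun _ _ hij => h.notMem_span _ _ (he.ne hij), fun _ _ _ _ h1 h2 h3 h4 h5 h6 =>
    h.notMem_span_pair _ _ _ _ (he.ne h1) (he.ne h2) (he.ne h3) (he.ne h4) (he.ne h5) (he.ne h6)⟩

/-- Otherwise `j` and `k` would both lie on the line through `c` and `i`. -/
theorem notMem_of_mem {ι : Type*} {q : ι → Fin n → ℝ} (h : NoFourCollinear q) {c i j k : ι}
    (hci : c ≠ i) (hcj : c ≠ j) (hck : c ≠ k) (hij : i ≠ j) (hik : i ≠ k) (hjk : j ≠ k)
    (hj : q c ∈ Submodule.span ℝ {q j, q i}) : q c ∉ Submodule.span ℝ {q k, q i} := fun hk =>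
  h.notMem_span_pair c i j k hci hcj hck hij hik hjk
    (mem_span_insert_exchange hj (h.notMem_span c i hci))
    (mem_span_insert_exchange hk (h.notMem_span c i hci))

theorem exists_conic {q : Fin 5 → Fin n → ℝ} (h : NoFourCollinear q) :
    ∃ p : MvPolynomial (Fin n) ℝ, p.IsHomogeneous 2 ∧
      (∀ j : Fin 4, eval (q j.succ) p = 0) ∧ eval (q 0) p ≠ 0 := by
  have key : ∀ i j k l : Fin 5, (∀ m : Fin 4, m.succ = i ∨ m.succ = j ∨ m.succ = k ∨ m.succ = l) →
      q 0 ∉ Submodule.span ℝ {q i, q j} → q 0 ∉ Submodule.span ℝ {q k, q l} →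
      ∃ p : MvPolynomial (Fin n) ℝ, p.IsHomogeneous 2 ∧
        (∀ j : Fin 4, eval (q j.succ) p = 0) ∧ eval (q 0) p ≠ 0 := by
    intro i j k l hm hij hkl
    obtain ⟨p, hp, hpi, hpj, hp0⟩ := exists_linear_form_through hij
    obtain ⟨r, hr, hrk, hrl, hr0⟩ := exists_linear_form_through hkl
    refine ⟨p * r, hp.mul hr, fun m => ?_, by simp [hp0, hr0]⟩
    rcases hm m with e | e | e | e <;> rw [e] <;> simp [*]
  -- The conic is a pair of lines. If the pairing 12|34 has a line through `q 0`, then 13|24 has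
  -- none.
  by_cases h1 : q 0 ∈ Submodule.span ℝ {q 1, q 2}
  · refine key 1 3 2 4 (by decide) ?_ ?_
    · rw [Set.pair_comm] at h1 ⊢
      exact h.notMem_of_mem (by decide) (by decide) (by decide) (by decide) (by decide) (by decide)
        h1
    · rw [Set.pair_comm]
      exact h.notMem_of_mem (by decide) (by decide) (by decide) (by decide) (by decide) (by decide)
        h1
  by_cases h2 : q 0 ∈ Submodule.span ℝ {q 3, q 4}
  · refine key 1 3 2 4 (by decide) ?_ ?_
    · rw [Set.pair_comm] at h2
      exact h.notMem_of_mem (by decide) (by decide) (by decide) (by decide) (by decide) (by decide)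
        h2
    · exact h.notMem_of_mem (by decide) (by decide) (by decide) (by decide) (by decide) (by decide)
        h2
  · exact key 1 2 3 4 (by decide) h1 h2

theorem exists_cubic {q : Fin 7 → Fin n → ℝ} (h : NoFourCollinear q) :
    ∃ p : MvPolynomial (Fin n) ℝ, p.IsHomogeneous 3 ∧
      (∀ j : Fin 6, eval (q j.succ) p = 0) ∧ eval (q 0) p ≠ 0 := by
  have key : ∀ (i j : Fin 7) (e : Fin 5 → Fin 7), Function.Injective e → e 0 = 0 →
      (∀ m : Fin 6, m.succ = i ∨ m.succ = j ∨ ∃ k : Fin 4, m.succ = e k.succ) →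
      q 0 ∉ Submodule.span ℝ {q i, q j} →
      ∃ p : MvPolynomial (Fin n) ℝ, p.IsHomogeneous 3 ∧
        (∀ j : Fin 6, eval (q j.succ) p = 0) ∧ eval (q 0) p ≠ 0 := by
    intro i j e he he0 hm hij
    obtain ⟨p, hp, hpi, hpj, hp0⟩ := exists_linear_form_through hij
    obtain ⟨r, hr, hre, hr0⟩ := (h.comp he).exists_conic
    simp only [Function.comp_apply, he0] at hre hr0
    refine ⟨p * r, hp.mul hr, fun m => ?_, by simp [hp0, hr0]⟩
    rcases hm m with e | e | ⟨k, e⟩ <;> rw [e] <;> simp [*]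
  by_cases h1 : q 0 ∈ Submodule.span ℝ {q 2, q 1}
  · exact key 3 1 ![0, 2, 4, 5, 6] (by decide) rfl (by decide) (h.notMem_of_mem (by decide)
      (by decide) (by decide) (by decide) (by decide) (by decide) h1)
  · exact key 2 1 ![0, 3, 4, 5, 6] (by decide) rfl (by decide) h1

theorem separated_two {q : Fin 5 → Fin n → ℝ} (h : NoFourCollinear q) : Separated 2 q :=
  separated_of_forall_perm fun σ => (h.comp σ.injective).exists_conic

theorem separated_three {q : Fin 7 → Fin n → ℝ} (h : NoFourCollinear q) : Separated 3 q :=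
  separated_of_forall_perm fun σ => (h.comp σ.injective).exists_cubic

end NoFourCollinear

namespace IsTransverseZeros

/-- A line through four of the points is excluded by `not_vanish_of_transverse`, with count `10 + 1
< 4 + 2 + 6`. -/
theorem noFourCollinear {ι : Type*} {f : Fin 2 → MvPolynomial (Fin 3) ℝ} {q : ι → Fin 3 → ℝ}
    (h : IsTransverseZeros 3 f q) : NoFourCollinear q := by
  refine ⟨h.notMem_span, fun i j k l hij hik hil hjk hjl hkl hk hl => ?_⟩
  have he : Function.Injective ![i, j, k, l] := by
    intro x y
    fin_cases x <;> fin_cases y <;> simp [*, Ne.symm]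
  obtain ⟨g, hg, hg0, hgS⟩ := exists_linear_form_vanishing ![q i, q j] (by simp)
  have hS : Set.range ![q i, q j] = {q i, q j} := by simp [Set.pair_comm]
  rw [hS] at hgS
  have h' := h.comp he
  obtain ⟨m, hm⟩ := not_vanish_of_transverse (e := 1) (d' := 2) rfl h'.form hg hg0
    (separated_of_notMem_span h'.notMem_span) h'.zero (h'.transverse 0) (by simp [Nat.multichoose_eq, Nat.choose])
  apply hm
  apply hgS
  fin_cases m
  · exact Submodule.subset_span (by simp)
  · exact Submodule.subset_span (by simp)
  · exact hk
  · exact hl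

theorem exists_cubic_of_two_lines {f : Fin 2 → MvPolynomial (Fin 3) ℝ} {q : Fin 8 → Fin 3 → ℝ}
    (h : IsTransverseZeros 3 f q) (h2 : q 0 ∉ Submodule.span ℝ {q 2, q 1})
    (h3 : q 0 ∉ Submodule.span ℝ {q 3, q 1}) :
    ∃ p : MvPolynomial (Fin 3) ℝ, p.IsHomogeneous 3 ∧
      (∀ j : Fin 7, eval (q j.succ) p = 0) ∧ eval (q 0) p ≠ 0 := by
  have hq := h.noFourCollinear
  have key : ∀ (i j : Fin 8) (e : Fin 5 → Fin 8),
      (∀ m : Fin 7, m.succ = i ∨ m.succ = j ∨ ∃ k, m.succ = e k) →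
      q 0 ∉ Submodule.span ℝ {q i, q j} →
      ∀ p : MvPolynomial (Fin 3) ℝ, p.IsHomogeneous 2 → (∀ k, eval (q (e k)) p = 0) →
      eval (q 0) p ≠ 0 →
      ∃ p : MvPolynomial (Fin 3) ℝ, p.IsHomogeneous 3 ∧
        (∀ j : Fin 7, eval (q j.succ) p = 0) ∧ eval (q 0) p ≠ 0 := by
    intro i j e hm hij r hr hre hr0
    obtain ⟨p, hp, hpi, hpj, hp0⟩ := exists_linear_form_through hij
    refine ⟨p * r, hp.mul hr, fun m => ?_, by simp [hp0, hr0]⟩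
    rcases hm m with e | e | ⟨k, e⟩ <;> rw [e] <;> simp [*]
  obtain ⟨Q, hQ, hQ0, hQe⟩ := exists_form_vanishing (d := 2) (q ∘ ![3, 4, 5, 6, 7])
    (by simp [Nat.multichoose_eq, Nat.choose])
  obtain ⟨R, hR, hR0, hRe⟩ := exists_form_vanishing (d := 2) (q ∘ ![2, 4, 5, 6, 7])
    (by simp [Nat.multichoose_eq, Nat.choose])
  by_contra hno
  have hQq : eval (q 0) Q = 0 := by
    by_contra hne
    exact hno (key 2 1 _ (by decide) h2 Q hQ hQe hne)
  have hRq : eval (q 0) R = 0 := by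
    by_contra hne
    exact hno (key 3 1 _ (by decide) h3 R hR hRe hne)
  simp only [Function.comp_apply, Fin.forall_fin_succ, Fin.isValue, Matrix.cons_val_zero,
    Matrix.cons_val_succ, IsEmpty.forall_iff, and_true] at hQe hRe
  obtain ⟨hQ3, hQ4, hQ5, hQ6, hQ7⟩ := hQe
  obtain ⟨hR2, hR4, hR5, hR6, hR7⟩ := hRe
  -- Both conics contain 0, 4, 5, 6, 7, and five points with no four collinear lie on only one
  -- conic, so `Q` and `R` are proportional. Then `Q` contains seven of the points, against the
  -- count `10 + 1 < 7 + 2 + 3`.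
  have hsep := (hq.comp (e := ![0, 4, 5, 6, 7]) (by decide)).separated_two
  obtain ⟨c, hc, hcQR⟩ := exists_ne_zero_map_eq_zero hsep
    (Fintype.linearCombination ℝ ![(⟨Q, hQ⟩ : homogeneousSubmodule (Fin 3) ℝ 2), ⟨R, hR⟩])
    (by
      intro x i
      fin_cases i <;> simp [Fintype.linearCombination_apply, smul_eval, *])
    (by rw [finrank_fintype_fun_eq_card]; simp [Nat.multichoose_eq, Nat.choose])
  have hsum : c 0 • Q + c 1 • R = 0 := by
    simpa [Fintype.linearCombination_apply] using congrArg Subtype.val hcQR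
  have hc0 : c 0 ≠ 0 := by
    intro h0
    rw [h0, zero_smul, zero_add, smul_eq_zero, or_iff_left hR0] at hsum
    exact hc (funext fun i => by fin_cases i <;> assumption)
  have hQ2 : eval (q 2) Q = 0 := by
    simpa [smul_eval, hR2, hc0] using congrArg (eval (q 2)) hsum
  have h' := h.comp (e := ![0, 2, 3, 4, 5, 6, 7]) (by decide)
  obtain ⟨m, hm⟩ := not_vanish_of_transverse (e := 2) (d' := 1) rfl h'.form hQ hQ0
    h'.noFourCollinear.separated_three h'.zero (h'.transverse 0) (by simp [Nat.multichoose_eq, Nat.choose])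
  fin_cases m <;> exact hm (by assumption)

theorem exists_cubic {f : Fin 2 → MvPolynomial (Fin 3) ℝ} {q : Fin 8 → Fin 3 → ℝ}
    (h : IsTransverseZeros 3 f q) :
    ∃ p : MvPolynomial (Fin 3) ℝ, p.IsHomogeneous 3 ∧
      (∀ j : Fin 7, eval (q j.succ) p = 0) ∧ eval (q 0) p ≠ 0 := by
  have hq := h.noFourCollinear
  have key : ∀ (e : Fin 8 → Fin 8), Function.Injective e → e 0 = 0 →
      (∀ m : Fin 7, ∃ k : Fin 7, m.succ = e k.succ) →
      q 0 ∉ Submodule.span ℝ {q (e 2), q (e 1)} → q 0 ∉ Submodule.span ℝ {q (e 3), q (e 1)} →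
      ∃ p : MvPolynomial (Fin 3) ℝ, p.IsHomogeneous 3 ∧
        (∀ j : Fin 7, eval (q j.succ) p = 0) ∧ eval (q 0) p ≠ 0 := by
    intro e he he0 hsurj h2 h3
    rw [← he0] at h2 h3
    obtain ⟨p, hp, hpe, hp0⟩ := (h.comp he).exists_cubic_of_two_lines h2 h3
    refine ⟨p, hp, fun m => ?_, by simpa [he0] using hp0⟩
    obtain ⟨k, hk⟩ := hsurj m
    rw [hk]
    exact hpe k
  by_cases h2 : q 0 ∈ Submodule.span ℝ {q 2, q 1}
  · refine key ![0, 1, 3, 4, 2, 5, 6, 7] (by decide) rfl (by decide) ?_ ?_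
    · exact hq.notMem_of_mem (by decide) (by decide) (by decide) (by decide) (by decide)
        (by decide) h2
    · exact hq.notMem_of_mem (by decide) (by decide) (by decide) (by decide) (by decide)
        (by decide) h2
  by_cases h3 : q 0 ∈ Submodule.span ℝ {q 3, q 1}
  · refine key ![0, 1, 2, 4, 3, 5, 6, 7] (by decide) rfl (by decide) h2 ?_
    exact hq.notMem_of_mem (by decide) (by decide) (by decide) (by decide) (by decide)
      (by decide) h3
  · exact key id Function.injective_id rfl (fun m => ⟨m, rfl⟩) h2 h3

end IsTransverseZeros

/-! ### Quaternary quadrics: seven of the eight points are separated -/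

theorem eval_add_of_isHomogeneous_one {p : MvPolynomial (Fin n) ℝ} (hp : p.IsHomogeneous 1)
    (s t : ℝ) (a b : Fin n → ℝ) :
    eval (s • a + t • b) p = s * eval a p + t * eval b p ∧ grad a p ⬝ᵥ b = eval b p := by
  rw [← mem_homogeneousSubmodule, homogeneousSubmodule_one_eq_span_X] at hp
  induction hp using Submodule.span_induction with
  | mem x hx =>
    obtain ⟨i, rfl⟩ := hx
    simp [dotProduct, grad_apply, pderiv_X, Pi.single_apply, apply_ite]
  | zero => simp
  | add x y _ _ hx hy =>
    simp only [map_add, add_dotProduct, hx, hy, and_true]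
    ring
  | smul c x _ hx =>
    simp only [map_smul, smul_dotProduct, smul_eval, hx, smul_eq_mul, and_true]
    ring

theorem eval_add_of_isHomogeneous_two {p : MvPolynomial (Fin n) ℝ} (hp : p.IsHomogeneous 2)
    (s t : ℝ) (a b : Fin n → ℝ) :
    eval (s • a + t • b) p = s ^ 2 * eval a p + s * t * (grad a p ⬝ᵥ b) + t ^ 2 * eval b p := by
  rw [← mem_homogeneousSubmodule, ← homogeneousSubmodule_one_pow, pow_two] at hp
  induction hp using Submodule.mul_induction_on' with
  | mem_mul_mem x hx y hy =>
    have hx' := eval_add_of_isHomogeneous_one hx s t a b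
    have hy' := eval_add_of_isHomogeneous_one hy s t a b
    rw [grad_mul]
    simp only [map_mul, add_dotProduct, smul_dotProduct, hx', hy', smul_eq_mul]
    ring
  | add x _ y _ hx hy =>
    simp only [map_add, add_dotProduct, hx, hy]
    ring

/-- On the line through `a` and `b` only the mixed term of `p` survives, and a third zero kills it.
The first equation is Euler's identity at a zero. -/
theorem grad_dotProduct_eq_zero {p : MvPolynomial (Fin n) ℝ} (hp : p.IsHomogeneous 2)
    {a b c : Fin n → ℝ} (ha : eval a p = 0) (hb : eval b p = 0) (hc : eval c p = 0)
    (hcab : c ∈ Submodule.span ℝ {a, b}) (hca : c ∉ Submodule.span ℝ {a})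
    (hcb : c ∉ Submodule.span ℝ {b}) : grad a p ⬝ᵥ a = 0 ∧ grad a p ⬝ᵥ b = 0 := by
  obtain ⟨s, t, rfl⟩ := Submodule.mem_span_pair.mp hcab
  have hs : s ≠ 0 := by
    rintro rfl
    exact hcb (by simpa using Submodule.smul_mem _ t (Submodule.mem_span_singleton_self b))
  have ht : t ≠ 0 := by
    rintro rfl
    exact hca (by simpa using Submodule.smul_mem _ s (Submodule.mem_span_singleton_self a))
  constructor
  · have h := eval_add_of_isHomogeneous_two hp 1 1 a a
    have h2 := eval_smul_of_isHomogeneous hp 2 a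
    rw [one_smul, ← two_smul ℝ a, h2] at h
    simpa [ha] using h.symm
  · rw [eval_add_of_isHomogeneous_two hp] at hc
    simpa [ha, hb, hs, ht] using hc

namespace IsTransverseZeros

variable {ι : Type*} {f : Fin 3 → MvPolynomial (Fin 4) ℝ}

/-- With three collinear points, the three gradients at `q i` would annihilate the independent
vectors `q i` and `q j`, but three independent covectors on `ℝ⁴` have a one-dimensional kernel. -/
theorem notMem_span_pair {q : ι → Fin 4 → ℝ} (h : IsTransverseZeros 2 f q) {i j k : ι}
    (hij : i ≠ j) (hik : i ≠ k) (hjk : j ≠ k) : q k ∉ Submodule.span ℝ {q i, q j} := by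
  intro hk
  let M : Matrix (Fin 3) (Fin 4) ℝ := Matrix.of fun l => grad (q i) (f l)
  have hrank : M.rank = 3 := by
    simpa using LinearIndependent.rank_matrix (M := M) (h.transverse i)
  have hgrad l := grad_dotProduct_eq_zero (h.form l) (h.zero l i) (h.zero l j) (h.zero l k) hk
    (h.notMem_span k i hik.symm) (h.notMem_span k j hjk.symm)
  have hker : finrank ℝ (LinearMap.ker M.mulVecLin) = 1 := by
    have := LinearMap.finrank_range_add_finrank_ker M.mulVecLin
    rw [← Matrix.rank, hrank, finrank_fintype_fun_eq_card, Fintype.card_fin] at this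
    omega
  have hi : q i ∈ LinearMap.ker M.mulVecLin := by
    rw [LinearMap.mem_ker, Matrix.mulVecLin_apply]
    exact funext fun l => (hgrad l).1
  have hj : q j ∈ LinearMap.ker M.mulVecLin := by
    rw [LinearMap.mem_ker, Matrix.mulVecLin_apply]
    exact funext fun l => (hgrad l).2
  have hi0 : (⟨q i, hi⟩ : LinearMap.ker M.mulVecLin) ≠ 0 := by
    intro h0
    have : q i = 0 := congrArg Subtype.val h0
    exact h.notMem_span i j hij (by simp [this])
  obtain ⟨c, hc⟩ := (finrank_eq_one_iff_of_nonzero' _ hi0).mp hker ⟨q j, hj⟩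
  refine h.notMem_span j i hij.symm (Submodule.mem_span_singleton.mpr ⟨c, ?_⟩)
  exact congrArg Subtype.val hc

theorem separated_two {q : Fin 5 → Fin 4 → ℝ} (h : IsTransverseZeros 2 f q) : Separated 2 q := by
  refine separated_of_forall_perm fun σ => ?_
  have h' := h.comp σ.injective
  obtain ⟨p, hp, hp1, hp2, hp0⟩ := exists_linear_form_through
    (h'.notMem_span_pair (i := 1) (j := 2) (k := 0) (by decide) (by decide) (by decide))
  obtain ⟨r, hr, hr3, hr4, hr0⟩ := exists_linear_form_through
    (h'.notMem_span_pair (i := 3) (j := 4) (k := 0) (by decide) (by decide) (by decide))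
  refine ⟨p * r, hp.mul hr, fun m => ?_, by simpa using ⟨hp0, hr0⟩⟩
  rw [map_mul, mul_eq_zero]
  fin_cases m
  exacts [Or.inl hp1, Or.inl hp2, Or.inr hr3, Or.inr hr4]

/-- Otherwise five of the points would be coplanar, which the count `10 + 1 < 5 + 3 + 4` excludes.
-/
theorem notMem_span_triple {q : ι → Fin 4 → ℝ} (h : IsTransverseZeros 2 f q) {e : Fin 5 → ι}
    (he : Function.Injective e) (h3 : q (e 0) ∈ Submodule.span ℝ {q (e 3), q (e 1), q (e 2)}) :
    q (e 0) ∉ Submodule.span ℝ {q (e 4), q (e 1), q (e 2)} := by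
  intro h4
  have h12 := h.notMem_span_pair (i := e 1) (j := e 2) (k := e 0) (he.ne (by decide))
    (he.ne (by decide)) (he.ne (by decide))
  replace h3 := mem_span_insert_exchange h3 h12
  replace h4 := mem_span_insert_exchange h4 h12
  obtain ⟨g, hg, hg0, hgS⟩ := exists_linear_form_vanishing ![q (e 0), q (e 1), q (e 2)] (by simp)
  have hS : Set.range ![q (e 0), q (e 1), q (e 2)] = {q (e 0), q (e 1), q (e 2)} := by
    simp only [Matrix.range_cons, Matrix.range_empty, Set.union_empty, Set.singleton_union]
  rw [hS] at hgS
  have h' := h.comp he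
  obtain ⟨m, hm⟩ := not_vanish_of_transverse (e := 1) (d' := 1) rfl h'.form hg hg0
    h'.separated_two h'.zero (h'.transverse 0) (by simp [Nat.multichoose_eq, Nat.choose])
  apply hm
  apply hgS
  fin_cases m
  · exact Submodule.subset_span (by simp)
  · exact Submodule.subset_span (by simp)
  · exact Submodule.subset_span (by simp)
  · exact h3
  · exact h4

theorem exists_quadric {q : Fin 7 → Fin 4 → ℝ} (h : IsTransverseZeros 2 f q) :
    ∃ p : MvPolynomial (Fin 4) ℝ, p.IsHomogeneous 2 ∧
      (∀ j : Fin 6, eval (q j.succ) p = 0) ∧ eval (q 0) p ≠ 0 := by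
  by_contra hno
  -- A pair of planes through complementary triples would be the required quadric, so in every
  -- splitting one plane contains `q 0`. Two such planes cannot share two of the six points (`hS`),
  -- and a few splittings contradict this.
  have key : ∀ i j k i' j' k' : Fin 7, (∀ m : Fin 6, m.succ = i ∨ m.succ = j ∨ m.succ = k ∨
      m.succ = i' ∨ m.succ = j' ∨ m.succ = k') → q 0 ∉ Submodule.span ℝ {q i, q j, q k} →
      q 0 ∈ Submodule.span ℝ {q i', q j', q k'} := by
    intro i j k i' j' k' hm hS
    by_contra hS'
    obtain ⟨p, hp, hpS, hp0⟩ := exists_linear_form_separating hS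
    obtain ⟨r, hr, hrS, hr0⟩ := exists_linear_form_separating hS'
    refine hno ⟨p * r, hp.mul hr, fun m => ?_, by simp [hp0, hr0]⟩
    rw [map_mul, mul_eq_zero]
    rcases hm m with e | e | e | e | e | e <;> rw [e]
    exacts [Or.inl (hpS _ (Submodule.subset_span (by simp))),
      Or.inl (hpS _ (Submodule.subset_span (by simp))),
      Or.inl (hpS _ (Submodule.subset_span (by simp))),
      Or.inr (hrS _ (Submodule.subset_span (by simp))),
      Or.inr (hrS _ (Submodule.subset_span (by simp))),
      Or.inr (hrS _ (Submodule.subset_span (by simp)))]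
  have hS : ∀ i j k l : Fin 7, Function.Injective ![0, i, j, k, l] →
      q 0 ∈ Submodule.span ℝ {q k, q i, q j} → q 0 ∉ Submodule.span ℝ {q l, q i, q j} :=
    fun i j k l he hk => h.notMem_span_triple (e := ![0, i, j, k, l]) he hk
  by_cases h0 : q 0 ∈ Submodule.span ℝ {q 1, q 2, q 3}
  · have h1 := key 4 2 3 5 1 6 (by decide) (hS 2 3 1 4 (by decide) h0)
    have h2 := key 5 2 3 4 1 6 (by decide) (hS 2 3 1 5 (by decide) h0)
    exact hS 1 6 5 4 (by decide) h1 h2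
  · replace h0 := key 1 2 3 4 5 6 (by decide) h0
    have h1 := key 1 5 6 2 4 3 (by decide) (hS 5 6 4 1 (by decide) h0)
    have h2 := key 2 5 6 1 4 3 (by decide) (hS 5 6 4 2 (by decide) h0)
    exact hS 4 3 2 1 (by decide) h1 h2

end IsTransverseZeros

/-! ### Closed polygons -/

theorem exists_sign_abs_sum_le {ι : Type*} (t : Finset ι) (s : ι → ℝ) {M : ℝ} (hM : 0 ≤ M)
    (hs : ∀ i ∈ t, 0 ≤ s i ∧ s i ≤ M) :
    ∃ ε : ι → ℝ, (∀ i, ε i = 1 ∨ ε i = -1) ∧ |∑ i ∈ t, s i * ε i| ≤ M := by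
  classical
  induction t using Finset.induction_on with
  | empty => exact ⟨fun _ => 1, by simp, by simpa⟩
  | insert i t hi ih =>
    obtain ⟨ε, hε, hsum⟩ := ih fun j hj => hs j (Finset.mem_insert_of_mem hj)
    obtain ⟨hi0, hiM⟩ := hs i (Finset.mem_insert_self i t)
    rw [abs_le] at hsum
    have hupd (c : ℝ) : ∑ j ∈ insert i t, s j * Function.update ε i c j =
        s i * c + ∑ j ∈ t, s j * ε j := by
      rw [Finset.sum_insert hi, Function.update_self]
      congr 1
      refine Finset.sum_congr rfl fun j hj => ?_
      rw [Function.update_of_ne (by rintro rfl; exact hi hj)]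
    have hpm (c : ℝ) (hc : c = 1 ∨ c = -1) (j : ι) :
        Function.update ε i c j = 1 ∨ Function.update ε i c j = -1 := by
      by_cases hj : j = i
      · subst hj
        simpa using hc
      · simpa [hj] using hε j
    -- Greedy choice: the new term gets the sign opposite to the partial sum.
    rcases le_total 0 (∑ j ∈ t, s j * ε j) with h | h
    · refine ⟨_, hpm (-1) (Or.inr rfl), ?_⟩
      rw [hupd, abs_le]
      constructor <;> linarith
    · refine ⟨_, hpm 1 (Or.inl rfl), ?_⟩
      rw [hupd, abs_le]
      constructor <;> linarith

/-- Side lengths satisfying the polygon inequalities are realized by a closed polygon. -/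
theorem exists_closed_polygon {ι : Type*} [Fintype ι] (s : ι → ℝ) (hs : ∀ i, 0 ≤ s i)
    (h : ∀ k, 2 * s k ≤ ∑ i, s i) : ∃ z : ι → ℂ, (∀ i, ‖z i‖ = s i) ∧ ∑ i, z i = 0 := by
  classical
  cases isEmpty_or_nonempty ι
  · exact ⟨fun _ => 0, fun i => isEmptyElim i, by simp⟩
  obtain ⟨k, hk⟩ := Finite.exists_max s
  -- The sides other than a longest one form a chain with directions `θ`. Its span is at most `s k`
  -- when folded by the signs `ε`, at least `s k` when straight, so equal to `s k` for some `θ` by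
  -- the intermediate value theorem.
  let F : (ι → ℝ) → ℂ := fun θ => ∑ i ∈ Finset.univ.erase k, s i * Complex.exp (θ i * Complex.I)
  have hF : Continuous fun θ => ‖F θ‖ := by fun_prop
  obtain ⟨ε, hε, hsum⟩ := exists_sign_abs_sum_le (Finset.univ.erase k) s (hs k)
    fun i _ => ⟨hs i, hk i⟩
  have hlow : ‖F fun i => if ε i = 1 then 0 else Real.pi‖ ≤ s k := by
    have : (F fun i => if ε i = 1 then 0 else Real.pi) =
        ((∑ i ∈ Finset.univ.erase k, s i * ε i : ℝ) : ℂ) := by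
      push_cast
      refine Finset.sum_congr rfl fun i _ => ?_
      rcases hε i with hi | hi
      · simp [hi]
      · have : (-1 : ℝ) ≠ 1 := by norm_num
        simp [hi, this]
    rw [this, Complex.norm_real]
    exact hsum
  have hhigh : s k ≤ ‖F fun _ => 0‖ := by
    have : (F fun _ => 0) = ((∑ i ∈ Finset.univ.erase k, s i : ℝ) : ℂ) := by
      simp [F]
    rw [this, Complex.norm_real, Real.norm_eq_abs]
    refine le_trans ?_ (le_abs_self _)
    have := h k
    rw [← Finset.add_sum_erase _ s (Finset.mem_univ k)] at this
    linarith
  obtain ⟨θ, hθ⟩ := mem_range_of_exists_le_of_exists_ge hF ⟨_, hlow⟩ ⟨_, hhigh⟩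
  refine ⟨fun i => if i = k then -F θ else s i * Complex.exp (θ i * Complex.I), fun i => ?_, ?_⟩
  · by_cases hi : i = k
    · simpa [hi] using hθ
    · simp [hi, Complex.norm_exp_ofReal_mul_I, abs_of_nonneg (hs i)]
  · rw [← Finset.add_sum_erase _ _ (Finset.mem_univ k), if_pos rfl, neg_add_eq_zero]
    refine Finset.sum_congr rfl fun i hi => ?_
    rw [if_neg (Finset.ne_of_mem_erase hi)]

/-! ### The Cayley–Bacharach relation -/

theorem IsRelation.eq_zero {m : ℕ} {v : Fin (m + 1) → Fin n → ℝ} {u : Fin (m + 1) → ℝ}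
    (hu : IsRelation d v u) {i₀ : Fin (m + 1)} (hs : Separated d (v ∘ i₀.succAbove))
    (h0 : u i₀ = 0) : u = 0 := by
  ext i
  by_cases hi : i = i₀
  · rw [hi, h0]
    rfl
  obtain ⟨k, rfl⟩ := Fin.exists_succAbove_eq hi
  obtain ⟨p, hp, hp0, hp1⟩ := hs k
  have h := hu p hp
  rw [Fin.sum_univ_succAbove _ i₀, h0, zero_mul, zero_add, Finset.sum_eq_single k] at h
  · exact (mul_eq_zero.mp h).resolve_right hp1
  · intro j _ hj
    rw [← Function.comp_apply (f := v), hp0 j hj, mul_zero]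
  · simp

theorem card_add_finrank_range_le {V W κ : Type*} [Fintype κ] [AddCommGroup V] [Module ℝ V]
    [FiniteDimensional ℝ V] [AddCommGroup W] [Module ℝ W] (E : V →ₗ[ℝ] W) {F : κ → V}
    (hF : LinearIndependent ℝ F) (hE : ∀ j, E (F j) = 0) :
    Fintype.card κ + finrank ℝ (LinearMap.range E) ≤ finrank ℝ V := by
  have hle : Submodule.span ℝ (Set.range F) ≤ LinearMap.ker E := by
    rw [Submodule.span_le]
    rintro _ ⟨j, rfl⟩
    exact hE j
  have := Submodule.finrank_mono hle
  rw [finrank_span_eq_card hF] at this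
  have := LinearMap.finrank_range_add_finrank_ker E
  omega

theorem IsTransverseZeros.exists_relation {κ : Type*} [Fintype κ] {m : ℕ}
    {f : κ → MvPolynomial (Fin n) ℝ} {v : Fin m → Fin n → ℝ} (h : IsTransverseZeros d f v)
    (i₀ : Fin m) (hdim : n.multichoose d < m + Fintype.card κ) :
    ∃ u, u ≠ 0 ∧ IsRelation d v u := by
  let E : homogeneousSubmodule (Fin n) ℝ d →ₗ[ℝ] (Fin m → ℝ) :=
    LinearMap.pi fun i => evalForm d (v i)
  have hE (p : homogeneousSubmodule (Fin n) ℝ d) (i : Fin m) :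
      E p i = eval (v i) (p : MvPolynomial (Fin n) ℝ) := by simp [E]
  have hF : LinearIndependent ℝ fun j => (⟨f j, h.form j⟩ : homogeneousSubmodule (Fin n) ℝ d) :=
    LinearIndependent.of_comp (grad (v i₀) ∘ₗ Submodule.subtype _) (h.transverse i₀)
  have hlt : LinearMap.range E < ⊤ := by
    apply Submodule.lt_top_of_finrank_lt_finrank
    have := card_add_finrank_range_le E hF fun j => by
      ext i
      rw [hE, h.zero j i, Pi.zero_apply]
    rw [finrank_homogeneousSubmodule] at this
    rw [finrank_fintype_fun_eq_card, Fintype.card_fin]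
    omega
  obtain ⟨φ, hφ0, hφ⟩ := Submodule.exists_le_ker_of_lt_top _ hlt
  have hsum (x : Fin m → ℝ) : φ x = ∑ i, φ (Pi.single i 1) * x i := by
    conv_lhs => rw [← Finset.univ_sum_single x, map_sum]
    refine Finset.sum_congr rfl fun i _ => ?_
    rw [mul_comm, ← smul_eq_mul, ← map_smul, ← Pi.single_smul, smul_eq_mul, mul_one]
  refine ⟨fun i => φ (Pi.single i 1), fun h0 => hφ0 ?_, fun p hp => ?_⟩
  · ext i
    exact congrFun h0 i
  · have : φ (E ⟨p, hp⟩) = 0 := hφ ⟨_, rfl⟩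
    rw [hsum] at this
    simpa only [hE] using this

theorem isRelation_smul_iff {m : ℕ} {v : Fin m → Fin n → ℝ} {u c : Fin m → ℝ} :
    IsRelation d (fun i => c i • v i) u ↔ IsRelation d v fun i => u i * c i ^ d := by
  refine forall₂_congr fun p hp => ?_
  rw [Finset.sum_congr rfl fun i _ => by rw [eval_smul_of_isHomogeneous hp, ← mul_assoc]]

/-- A functional separating `y` from the image of evaluation would be a relation, hence a multiple
of `a`, and so would vanish at `y`. -/
theorem exists_form_eval_eq {m : ℕ} {w : Fin m → Fin n → ℝ} {a : Fin m → ℝ}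
    (ha : ∀ u, IsRelation d w u → ∃ c : ℝ, u = c • a) {y : Fin m → ℝ}
    (hy : ∑ i, a i * y i = 0) :
    ∃ p : MvPolynomial (Fin n) ℝ, p.IsHomogeneous d ∧ ∀ i, eval (w i) p = y i := by
  let E : homogeneousSubmodule (Fin n) ℝ d →ₗ[ℝ] (Fin m → ℝ) :=
    LinearMap.pi fun i => evalForm d (w i)
  have hE (p : homogeneousSubmodule (Fin n) ℝ d) (i : Fin m) :
      E p i = eval (w i) (p : MvPolynomial (Fin n) ℝ) := by simp [E]
  suffices hmem : y ∈ LinearMap.range E by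
    obtain ⟨p, rfl⟩ := hmem
    exact ⟨p, p.2, fun i => (hE p i).symm⟩
  by_contra hmem
  obtain ⟨φ, hφy, hφ⟩ := Submodule.exists_le_ker_of_notMem hmem
  have hsum (x : Fin m → ℝ) : φ x = ∑ i, φ (Pi.single i 1) * x i := by
    conv_lhs => rw [← Finset.univ_sum_single x, map_sum]
    refine Finset.sum_congr rfl fun i _ => ?_
    rw [mul_comm, ← smul_eq_mul, ← map_smul, ← Pi.single_smul, smul_eq_mul, mul_one]
  obtain ⟨c, hc⟩ := ha (fun i => φ (Pi.single i 1)) fun p hp => by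
    have : φ (E ⟨p, hp⟩) = 0 := hφ ⟨_, rfl⟩
    rw [hsum] at this
    simpa only [hE] using this
  apply hφy
  rw [hsum, Finset.sum_congr rfl fun i _ => by rw [congrFun hc i, Pi.smul_apply, smul_eq_mul,
    mul_assoc], ← Finset.mul_sum, hy, mul_zero]

/-! ### The image of the cone of sums of squares -/

theorem evalAt_mem_T {m : ℕ} {w : Fin m → Fin n → ℝ} {a : Fin m → ℝ} (ha : ∀ i, |a i| = 1)
    (hw : IsRelation d w a) {p : MvPolynomial (Fin n) ℝ} (hp : p ∈ sosCone n d) :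
    evalAt w p ∈ T m := by
  obtain ⟨-, r, q, hq, rfl⟩ := hp
  let Y : Fin m → EuclideanSpace ℝ (Fin r) := fun i => WithLp.toLp 2 fun j => eval (w i) (q j)
  have hx (i : Fin m) : evalAt w (∑ j, q j ^ 2) i = ∑ j, eval (w i) (q j) ^ 2 := by
    simp [evalAt]
  have hY (i : Fin m) : ‖a i • Y i‖ = √(evalAt w (∑ j, q j ^ 2) i) := by
    rw [norm_smul, Real.norm_eq_abs, ha, one_mul, EuclideanSpace.norm_eq, hx]
    simp [Y]
  have hsum : ∑ i, a i • Y i = 0 := by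
    ext j
    simpa [Y] using hw (q j) (hq j)
  refine ⟨fun i => ?_, fun k => ?_⟩
  · rw [hx]
    positivity
  · simp only [← hY]
    rw [← Finset.add_sum_erase _ _ (Finset.mem_univ k)] at hsum ⊢
    rw [two_mul, eq_neg_of_add_eq_zero_left hsum, norm_neg, add_le_add_iff_left]
    exact norm_sum_le _ _

theorem image_evalAt_sosCone {m : ℕ} {w : Fin m → Fin n → ℝ} {a : Fin m → ℝ}
    (ha : ∀ i, |a i| = 1) (hw : IsRelation d w a)
    (huniq : ∀ u, IsRelation d w u → ∃ c : ℝ, u = c • a) :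
    evalAt w '' sosCone n d = T m := by
  apply Set.Subset.antisymm
  · rintro _ ⟨p, hp, rfl⟩
    exact evalAt_mem_T ha hw hp
  rintro x ⟨hx0, hx⟩
  obtain ⟨z, hz, hz0⟩ := exists_closed_polygon (fun i => √(x i)) (fun i => Real.sqrt_nonneg _) hx
  have ha2 (i : Fin m) : a i * a i = 1 := by rw [← abs_mul_abs_self, ha, one_mul]
  obtain ⟨p, hp, hpw⟩ := exists_form_eval_eq huniq (y := fun i => a i * (z i).re) (by
    simp only [← mul_assoc, ha2, one_mul]
    simpa using congrArg Complex.re hz0)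
  obtain ⟨q, hq, hqw⟩ := exists_form_eval_eq huniq (y := fun i => a i * (z i).im) (by
    simp only [← mul_assoc, ha2, one_mul]
    simpa using congrArg Complex.im hz0)
  have hforms : p ^ 2 + q ^ 2 ∈ forms n (2 * d) := by
    rw [mul_comm]
    exact (hp.pow 2).add (hq.pow 2)
  refine ⟨p ^ 2 + q ^ 2, ⟨hforms, 2, ![p, q], ?_, by simp⟩, ?_⟩
  · intro j
    fin_cases j
    exacts [hp, hq]
  · ext i
    have hnorm : (z i).re * (z i).re + (z i).im * (z i).im = x i := by
      rw [← Complex.normSq_apply, Complex.normSq_eq_norm_sq, hz, Real.sq_sqrt (hx0 i)]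
    simp only [evalAt, map_add, map_pow, hpw, hqw]
    linear_combination ((z i).re * (z i).re + (z i).im * (z i).im) * ha2 i + hnorm

theorem relation_and_image {m : ℕ} (hd : d ≠ 0) {v : Fin (m + 1) → Fin n → ℝ}
    (hs : ∀ i₀ : Fin (m + 1), Separated d (v ∘ i₀.succAbove))
    (hrel : ∃ u, u ≠ 0 ∧ IsRelation d v u) :
    (∃ u : Fin (m + 1) → ℝ,
      (∀ i, u i ≠ 0) ∧
      (∀ u', IsRelation d v u' ↔ ∃ c : ℝ, u' = c • u) ∧
      IsRelation d (fun i => (|u i| ^ (1 / (d : ℝ))) • v i) (fun i => u i / |u i|)) ∧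
    (∀ w : Fin (m + 1) → Fin n → ℝ, (∀ i, ∃ c : ℝ, c ≠ 0 ∧ w i = c • v i) →
      ∀ a : Fin (m + 1) → ℝ, (∀ i, |a i| = 1) → IsRelation d w a →
        evalAt w '' sosCone n d = T (m + 1)) := by
  obtain ⟨u, hu0, hu⟩ := hrel
  have hne : ∀ u', u' ≠ 0 → IsRelation d v u' → ∀ i, u' i ≠ 0 := fun u' hu' h i hi =>
    hu' (h.eq_zero (hs i) hi)
  have huniq : ∀ u₁, u₁ ≠ 0 → IsRelation d v u₁ → ∀ u', IsRelation d v u' →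
      ∃ c : ℝ, u' = c • u₁ := by
    intro u₁ hu₁ h₁ u' h'
    -- This multiple makes the coefficient of the difference at index 0 vanish.
    refine ⟨u' 0 / u₁ 0, sub_eq_zero.mp (IsRelation.eq_zero (d := d) (v := v) (fun p hp => ?_)
      (hs 0) ?_)⟩
    · simp only [Pi.sub_apply, Pi.smul_apply, smul_eq_mul, sub_mul, Finset.sum_sub_distrib,
        mul_assoc, ← Finset.mul_sum]
      rw [h' p hp, h₁ p hp, mul_zero, sub_zero]
    · simp [hne u₁ hu₁ h₁ 0]
  refine ⟨⟨u, hne u hu0 hu, fun u' => ⟨huniq u hu0 hu u', ?_⟩, ?_⟩, fun w hw a ha hwa => ?_⟩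
  · rintro ⟨c, rfl⟩ p hp
    simp only [Pi.smul_apply, smul_eq_mul, mul_assoc, ← Finset.mul_sum]
    rw [hu p hp, mul_zero]
  · rw [isRelation_smul_iff]
    convert hu using 2 with i
    rw [one_div, Real.rpow_inv_natCast_pow (abs_nonneg _) hd,
      div_mul_cancel₀ _ (abs_ne_zero.mpr (hne u hu0 hu i))]
  · choose c hc hwc using hw
    obtain rfl : w = fun i => c i • v i := funext hwc
    refine image_evalAt_sosCone ha hwa fun u' hu' => ?_
    rw [isRelation_smul_iff] at hwa hu'
    have ha0 (i) : a i ≠ 0 := abs_ne_zero.mp (by rw [ha]; exact one_ne_zero)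
    obtain ⟨b, hb⟩ := huniq _ (fun h0 => mul_ne_zero (ha0 0) (pow_ne_zero d (hc 0)) (congrFun h0 0))
      hwa _ hu'
    refine ⟨b, funext fun i => mul_right_cancel₀ (pow_ne_zero d (hc i)) ?_⟩
    rw [congrFun hb i]
    simp [mul_assoc]

/-! ### Passage from the complete intersection to its real points -/

theorem IsFullyRealTransverseIntersection.isTransverseZeros {k m : ℕ}
    {f : Fin k → MvPolynomial (Fin n) ℝ} {v : Fin m → Fin n → ℝ}
    (h : IsFullyRealTransverseIntersection d f v) : IsTransverseZeros d f v where
  form := h.form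
  zero j i := by
    have h0 := (h.zeros (fun l => (v i l : ℂ)) fun h0 => h.ne_zero i (funext fun l => by
      simpa using congrFun h0 l)).mpr ⟨i, 1, by simp⟩ j
    have h1 : aeval (fun l => (v i l : ℂ)) (f j) = ((eval (v i) (f j) : ℝ) : ℂ) := by
      rw [← aeval_eq_eval]
      exact aeval_algebraMap_apply ℂ (v i) (f j)
    rw [h1] at h0
    exact_mod_cast h0
  notMem_span i j hij hmem := by
    obtain ⟨c, hc⟩ := Submodule.mem_span_singleton.mp hmem
    exact h.distinct i j hij c hc.symm
  transverse i := by
    convert h.transverse i using 3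
    exact grad_apply _ _ _

theorem IsTransverseZeros.separated_comp_succAbove {κ : Type*} {m : ℕ}
    {f : κ → MvPolynomial (Fin n) ℝ} {v : Fin (m + 2) → Fin n → ℝ} (h : IsTransverseZeros d f v)
    (hex : ∀ q : Fin (m + 1) → Fin n → ℝ, IsTransverseZeros d f q →
      ∃ p : MvPolynomial (Fin n) ℝ, p.IsHomogeneous d ∧
        (∀ j : Fin m, eval (q j.succ) p = 0) ∧ eval (q 0) p ≠ 0) (i₀ : Fin (m + 2)) :
    Separated d (v ∘ i₀.succAbove) :=
  separated_of_forall_perm fun σ =>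
    hex (fun j => v (i₀.succAbove (σ j))) (h.comp (e := fun j => i₀.succAbove (σ j))
      (Fin.succAbove_right_injective.comp σ.injective))

end CayleyBacharach

theorem mainTheorem6 (n d : ℕ) (hnd : (n = 3 ∧ d = 3) ∨ (n = 4 ∧ d = 2))
    (f : Fin (n - 1) → MvPolynomial (Fin n) ℝ) (v : Fin (d ^ (n - 1)) → Fin n → ℝ)
    (hfv : CayleyBacharach.IsFullyRealTransverseIntersection d f v) :
    -- the Cayley–Bacharach relation on the `v i`: it has nonzero coefficients, is unique up to
    -- a scalar, and gets coefficients `±1` after rescaling the affine representatives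
    (∃ u : Fin (d ^ (n - 1)) → ℝ,
      (∀ i, u i ≠ 0) ∧
      (∀ u', CayleyBacharach.IsRelation d v u' ↔ ∃ c : ℝ, u' = c • u) ∧
      CayleyBacharach.IsRelation d (fun i => (|u i| ^ (1 / (d : ℝ))) • v i)
        (fun i => u i / |u i|)) ∧
    -- for all such affine representatives `w i`, the image of the sos cone is `T_m`
    (∀ w : Fin (d ^ (n - 1)) → Fin n → ℝ, (∀ i, ∃ c : ℝ, c ≠ 0 ∧ w i = c • v i) →
      ∀ a : Fin (d ^ (n - 1)) → ℝ, (∀ i, |a i| = 1) → CayleyBacharach.IsRelation d w a →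
        CayleyBacharach.evalAt w '' CayleyBacharach.sosCone n d =
          CayleyBacharach.T (d ^ (n - 1))) := by
  have h := hfv.isTransverseZeros
  rcases hnd with ⟨rfl, rfl⟩ | ⟨rfl, rfl⟩
  · exact CayleyBacharach.relation_and_image (m := 8) (by decide)
      (h.separated_comp_succAbove (m := 7) fun q hq => hq.exists_cubic)
      (h.exists_relation (m := 9) 0 (by simp [Nat.multichoose_eq, Nat.choose]))
  · exact CayleyBacharach.relation_and_image (m := 7) (by decide)
      (h.separated_comp_succAbove (m := 6) fun q hq => hq.exists_quadric)
      (h.exists_relation (m := 8) 0 (by simp [Nat.multichoose_eq, Nat.choose]))
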